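/- Let $\Phi=\{x_i\}_{i\ge 0}\subset\mathbb{R}^2$ be a stationary planar Poisson point process of density $\lambda>0$ (the interferers), and let $d>0$ (distance of the desired transmitter), $\mathtt{SNR}>0$ and $T>0$. Let $g_1,g_2$ and $h_{n,i}$ ($n=1,2$, $i\ge 0$) be the power fading gains from the desired transmitter, respectively from the $i$-th interferer, to the $n$-th antenna. Assume Rayleigh fading ($m_{\mathrm D}=m_{\mathrm I}=1$), that is, all $g_n$ and $h_{n,i}$ are exponentially distributed with mean $1$, mutually independent, and jointly independent of $(x_i)_{i\ge0}$. Let the path loss exponent be $\alpha=4$, let $$I_n=d^{4}\sum_{i\ge 0}h_{n,i}\|x_i\|^{-4},\qquad \mathtt{SINR}_{\mathrm{MRC}}=\frac{g_1}{I_1+\mathtt{SNR}^{-1}}+\frac{g_2}{I_2+\mathtt{SNR}^{-1}},$$ and write $(y)^+=\max\{0,y\}$. Then the dual-branch success probability is $$\mathbb{P}\left(\mathtt{SINR}_{\mathrm{MRC}}\ge T\right)=-\int_0^\infty z^{-1}\exp\left(-\frac{(T-z)^+}{\mathtt{SNR}}\right)\frac{\partial}{\partial t}\left[\exp\left(-\frac{zt}{\mathtt{SNR}}-\frac{\lambda\pi^2d^2}{2}\,\frac{((T-z)^+)^{3/2}-(zt)^{3/2}}{(T-z)^+-zt}\right)\right]_{t=1}\,dz,$$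 where the $t$-derivative exists for every $z>0$ with $z\ne T/2$, and the integrand is Lebesgue integrable on $(0,\infty)$. -/

import Mathlib

open MeasureTheory ProbabilityTheory Set

noncomputable section

/-- The Euclidean plane. -/
abbrev Plane : Type := EuclideanSpace ℝ (Fin 2)

/-- The random counting measure `∑ i, δ_{x i}` of the random points `x i`, evaluated at the
set `B`: for measurable `B`, the number of indices `i` with `x i ω ∈ B`. -/
def pointCount {Ω : Type*} (x : ℕ → Ω → Plane) (B : Set Plane) (ω : Ω) : ENNReal :=
  Measure.sum (fun i => Measure.dirac (x i ω)) B

/-- The random points `x 0, x 1, …` form a stationary planar Poisson point process of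
density `lam`: counts in Borel sets of finite area are Poisson distributed with mean
`lam * area`, and counts in pairwise disjoint Borel sets are independent. -/
structure IsPlanarPPP {Ω : Type*} [MeasurableSpace Ω] (P : Measure Ω) (lam : ℝ)
    (x : ℕ → Ω → Plane) : Prop where
  measurable : ∀ i, Measurable (x i)
  poisson : ∀ B : Set Plane, MeasurableSet B → volume B ≠ ⊤ → ∀ k : ℕ,
    P {ω | pointCount x B ω = (k : ENNReal)} =
      ENNReal.ofReal (Real.exp (-(lam * (volume B).toReal)) *
        (lam * (volume B).toReal) ^ k / (Nat.factorial k : ℝ))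
  indep : ∀ (k : ℕ) (B : Fin k → Set Plane), (∀ j, MeasurableSet (B j)) →
    Pairwise (fun i j => Disjoint (B i) (B j)) →
    iIndepFun (fun j ω => pointCount x (B j) ω) P

/-- The network with `N` receive antennas: `x i` is the location of the `i`-th interferer,
`g n` the power fading gain from the desired transmitter to antenna `n`, and `h n i` the power
fading gain from interferer `i` to antenna `n`. Gains are Gamma distributed with shape `m` and
rate `m` (scale `1 / m`), where `m = mD` on desired and `m = mI` on interfering links; all gains
are mutually independent, and jointly independent of the interferer locations. -/
structure IsNakagamiNetwork {Ω : Type*} [MeasurableSpace Ω] (P : Measure Ω) (N : ℕ)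
    (lam : ℝ) (mD : ℕ) (mI : ℝ) (x : ℕ → Ω → Plane) (g : Fin N → Ω → ℝ)
    (h : Fin N → ℕ → Ω → ℝ) : Prop where
  ppp : IsPlanarPPP P lam x
  measurable_g : ∀ n, Measurable (g n)
  measurable_h : ∀ n i, Measurable (h n i)
  law_g : ∀ n, P.map (g n) = gammaMeasure (mD : ℝ) (mD : ℝ)
  law_h : ∀ n i, P.map (h n i) = gammaMeasure mI mI
  indep_gains : iIndepFun
    (Sum.elim g (fun p : Fin N × ℕ => h p.1 p.2) : Fin N ⊕ (Fin N × ℕ) → Ω → ℝ) P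
  indep_points : IndepFun (fun ω (i : ℕ) => x i ω)
    (fun ω (j : Fin N ⊕ (Fin N × ℕ)) =>
      (Sum.elim g (fun p : Fin N × ℕ => h p.1 p.2) : Fin N ⊕ (Fin N × ℕ) → Ω → ℝ) j ω) P

/-- Interference power `d ^ α * ∑ i, h i * ‖x i‖ ^ (-α)` at one antenna with interferer gains
`h`, as a value in `[0, ∞]`. -/
def interference {Ω : Type*} (d α : ℝ) (x : ℕ → Ω → Plane) (h : ℕ → Ω → ℝ) (ω : Ω) : ENNReal :=
  ENNReal.ofReal (d ^ α) *
    ∑' i, ENNReal.ofReal (h i ω) * (ENNReal.ofReal ‖x i ω‖) ^ (-α)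

/-- Post-combiner SINR of interference-aware MRC: `∑ n, g n / (I n + SNR⁻¹)`. -/
def sinrMRC {Ω : Type*} {N : ℕ} (d α SNR : ℝ) (x : ℕ → Ω → Plane) (g : Fin N → Ω → ℝ)
    (h : Fin N → ℕ → Ω → ℝ) (ω : Ω) : ENNReal :=
  ∑ n, ENNReal.ofReal (g n ω) / (interference d α x (h n) ω + ENNReal.ofReal SNR⁻¹)

/-- Success probability: the probability that the post-combiner SINR is at least `T`. -/
def successProb {Ω : Type*} [MeasurableSpace Ω] (P : Measure Ω) {N : ℕ} (d α SNR T : ℝ)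
    (x : ℕ → Ω → Plane) (g : Fin N → Ω → ℝ) (h : Fin N → ℕ → Ω → ℝ) : ℝ :=
  P.real {ω | ENNReal.ofReal T ≤ sinrMRC d α SNR x g h ω}

/-- The elementary exponential that is differentiated in `t`. -/
def mrcExp (lam d SNR T z t : ℝ) : ℝ :=
  Real.exp (-(z * t / SNR) - lam * Real.pi ^ 2 * d ^ 2 / 2 *
    (((max 0 (T - z)) ^ (3 / 2 : ℝ) - (z * t) ^ (3 / 2 : ℝ)) / (max 0 (T - z) - z * t)))

/-- The integrand: `z⁻¹ exp(-(T - z)⁺ / SNR)` times the `t`-derivative of `mrcExp` at `t = 1`. -/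
def mrcIntegrand (lam d SNR T z : ℝ) : ℝ :=
  z⁻¹ * Real.exp (-(max 0 (T - z) / SNR)) * deriv (fun t => mrcExp lam d SNR T z t) 1

end

/-! Given the interference, the two branch SINRs are independent exponential variables with rates
`r₁ = I₁ + SNR⁻¹` and `r₂ = I₂ + SNR⁻¹`. Conditioning on the value `z` of the second branch gives
the success probability as `∫ r₂ exp(-z r₂) exp(-(T - z)⁺ r₁) dz` (`expMeasure_prod_sum_ge`), to be
averaged over the interference. Since `r₂ exp(-z r₂)` is `-z⁻¹` times the `t`-derivative of `exp(-z
t r₂)` at `t = 1`, the average is read off from the joint Laplace transform `E exp(-a I₁ - b I₂)` at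
`a = (T - z)⁺`, `b = z t`, by differentiating under the expectation (`hasDerivAt_integral_exp_mul`).

For that transform, averaging the Rayleigh gains at fixed points leaves a product over the
interferers of `1 / ((1 + a c) (1 + b c))` with `c = d⁴ ‖x i‖⁻⁴`. The Laplace functional of the
Poisson process (`IsPlanarPPP.laplace`) turns it into the exponential of an area integral, which for
path loss exponent four has an arctangent primitive (`radial_integral`).

Interference is kept in `[0, ∞]`, so nothing about convergence of the series is needed beforehand;
almost sure finiteness follows from the transform near zero. Integrability also comes for free:
minus the integrand is almost everywhere a nonnegative function whose integral is a probability. -/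

section InterferenceLaplace

open Filter Topology
open scoped ENNReal

/-! ### The exponential of a negated extended nonnegative number -/

/-- The function `y ↦ exp (-y)` on `[0, ∞]`. -/
noncomputable def expNeg (y : ℝ≥0∞) : ℝ≥0∞ := (EReal.exp (y : EReal))⁻¹

lemma expNeg_zero : expNeg 0 = 1 := by simp [expNeg]

lemma expNeg_top : expNeg ⊤ = 0 := by simp [expNeg]

lemma expNeg_ofReal {y : ℝ} (hy : 0 ≤ y) :
    expNeg (ENNReal.ofReal y) = ENNReal.ofReal (Real.exp (-y)) := by
  rw [expNeg, EReal.coe_ennreal_ofReal, max_eq_left hy, EReal.exp_coe, Real.exp_neg,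
    ENNReal.ofReal_inv_of_pos (Real.exp_pos y)]

lemma expNeg_add (a b : ℝ≥0∞) : expNeg (a + b) = expNeg a * expNeg b := by
  rw [expNeg, EReal.coe_ennreal_add, EReal.exp_add, ENNReal.mul_inv]
  · rfl
  · left; simp
  · right; simp

lemma expNeg_sum {ι : Type*} (s : Finset ι) (f : ι → ℝ≥0∞) :
    expNeg (∑ i ∈ s, f i) = ∏ i ∈ s, expNeg (f i) := by
  classical
  induction s using Finset.induction_on with
  | empty => simp [expNeg_zero]
  | insert a s ha ih => rw [Finset.sum_insert ha, Finset.prod_insert ha, expNeg_add, ih]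

lemma continuous_expNeg : Continuous expNeg :=
  continuous_inv.comp (ENNReal.continuous_exp.comp continuous_coe_ennreal_ereal)

lemma measurable_expNeg : Measurable expNeg := continuous_expNeg.measurable

lemma antitone_expNeg : Antitone expNeg := fun a b hab => by
  rw [expNeg, expNeg, ENNReal.inv_le_inv, EReal.exp_le_exp_iff]
  exact_mod_cast hab

lemma expNeg_le_one (y : ℝ≥0∞) : expNeg y ≤ 1 := by
  rw [← expNeg_zero]; exact antitone_expNeg zero_le

/-- The limit of expectations of `expNeg` along a convergent sequence. -/
lemma tendsto_lintegral_expNeg {α : Type*} [MeasurableSpace α] {μ : Measure α} [IsFiniteMeasure μ]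
    {F : ℕ → α → ℝ≥0∞} {f : α → ℝ≥0∞} (hF : ∀ n, Measurable (F n))
    (h : ∀ a, Tendsto (fun n => F n a) atTop (𝓝 (f a))) :
    Tendsto (fun n => ∫⁻ a, expNeg (F n a) ∂μ) atTop (𝓝 (∫⁻ a, expNeg (f a) ∂μ)) := by
  refine tendsto_lintegral_of_dominated_convergence (fun _ => 1)
    (fun n => measurable_expNeg.comp (hF n)) (fun n => ae_of_all _ fun a => expNeg_le_one _)
    (by simp) (ae_of_all _ fun a => (continuous_expNeg.tendsto _).comp (h a))

/-! ### Laplace functional of the Poisson process -/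

lemma measurable_pointCount {Ω : Type*} [MeasurableSpace Ω] {x : ℕ → Ω → Plane}
    (hx : ∀ i, Measurable (x i)) {B : Set Plane} (hB : MeasurableSet B) :
    Measurable (pointCount x B) := by
  unfold pointCount
  simp_rw [Measure.sum_apply _ hB, Measure.dirac_apply' _ hB]
  exact Measurable.tsum fun i => (measurable_const.indicator hB).comp (hx i)

/-- The Laplace transform of a Poisson random variable with values in `[0, ∞]`. -/
lemma lintegral_expNeg_poisson {Ω : Type*} [MeasurableSpace Ω] (P : Measure Ω)
    [IsProbabilityMeasure P] {N : Ω → ℝ≥0∞} (hN : Measurable N) {m : ℝ} (hm : 0 ≤ m)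
    (hP : ∀ k : ℕ, P {ω | N ω = k} =
      ENNReal.ofReal (Real.exp (-m) * m ^ k / (Nat.factorial k : ℝ))) {c : ℝ≥0∞} (hc : c ≠ ⊤) :
    ∫⁻ ω, expNeg (c * N ω) ∂P = expNeg (ENNReal.ofReal m * (1 - expNeg c)) := by
  have hexp : ∀ q : ℝ, HasSum (fun k : ℕ => q ^ k / (Nat.factorial k : ℝ)) (Real.exp q) := fun q => by
    rw [Real.exp_eq_exp_ℝ]; exact NormedSpace.expSeries_div_hasSum_exp q
  have hmeas : ∀ k : ℕ, MeasurableSet {ω | N ω = k} := fun k => hN (measurableSet_singleton _)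
  have hdisj : Pairwise (Function.onFun Disjoint fun k : ℕ => {ω | N ω = k}) := by
    intro i j hij
    refine Set.disjoint_left.mpr fun ω hi hj => hij ?_
    simp only [mem_ofPred_eq] at hi hj
    exact_mod_cast hi.symm.trans hj
  have hsum : ∀ q : ℝ, 0 ≤ q →
      ∑' k : ℕ, ENNReal.ofReal (Real.exp (-m) * (q ^ k / (Nat.factorial k : ℝ)))
        = ENNReal.ofReal (Real.exp (-m) * Real.exp q) := fun q hq => by
    rw [← ENNReal.ofReal_tsum_of_nonneg (fun k => by positivity) ((hexp q).mul_left _).summable,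
      ((hexp q).mul_left _).tsum_eq]
  -- The Poisson masses already add up to one, so `N` is almost surely a natural number and the
  -- integral splits over the events `N = k`.
  have hfull : P (⋃ k : ℕ, {ω | N ω = k}) = 1 := by
    rw [measure_iUnion hdisj hmeas]
    simp_rw [hP, mul_div_assoc]
    rw [hsum m hm, ← Real.exp_add]; simp
  have hae : ∀ᵐ ω ∂P, ω ∈ ⋃ k : ℕ, {ω | N ω = k} := by
    rw [← prob_compl_eq_zero_iff (MeasurableSet.iUnion hmeas)] at hfull
    exact hfull
  conv_lhs => rw [← Measure.restrict_eq_self_of_ae_mem hae]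
  rw [lintegral_iUnion hmeas hdisj]
  obtain ⟨c, hc0, rfl⟩ : ∃ r : ℝ, 0 ≤ r ∧ ENNReal.ofReal r = c :=
    ⟨c.toReal, ENNReal.toReal_nonneg, ENNReal.ofReal_toReal hc⟩
  have hterm : ∀ k : ℕ, ∫⁻ ω in {ω | N ω = k}, expNeg (ENNReal.ofReal c * N ω) ∂P
      = ENNReal.ofReal (Real.exp (-m) * ((m * Real.exp (-c)) ^ k / (Nat.factorial k : ℝ))) := by
    intro k
    rw [setLIntegral_congr_fun (g := fun _ => expNeg (ENNReal.ofReal c * k)) (hmeas k)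
      (fun ω hω => by rw [mem_ofPred_eq] at hω; simp only [hω]), setLIntegral_const, hP,
      ← ENNReal.ofReal_natCast, ← ENNReal.ofReal_mul hc0, expNeg_ofReal (by positivity),
      ← ENNReal.ofReal_mul (by positivity), mul_pow, ← Real.exp_nat_mul]
    congr 1
    rw [show (k : ℝ) * -c = -(c * k) by ring]
    ring
  simp_rw [hterm]
  have h1 : Real.exp (-c) ≤ 1 := Real.exp_le_one_iff.mpr (by linarith)
  rw [hsum _ (by positivity), expNeg_ofReal hc0, ← ENNReal.ofReal_one,
    ← ENNReal.ofReal_sub _ (by positivity), ← ENNReal.ofReal_mul hm, expNeg_ofReal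
      (mul_nonneg hm (by linarith)), ← Real.exp_add]
  congr 2
  ring

/-- The Laplace functional of a planar Poisson point process at a simple function whose level
sets have finite area. -/
lemma IsPlanarPPP.laplace_simpleFunc {Ω : Type*} [MeasurableSpace Ω] {P : Measure Ω}
    [IsProbabilityMeasure P] {lam : ℝ} (hlam : 0 ≤ lam) {x : ℕ → Ω → Plane}
    (hx : IsPlanarPPP P lam x) (f : SimpleFunc Plane ℝ≥0∞) (hf : ∀ y, f y ≠ ⊤)
    (hfin : ∀ c, c ≠ 0 → volume (f ⁻¹' {c}) ≠ ⊤) :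
    ∫⁻ ω, expNeg (∑' i, f (x i ω)) ∂P =
      expNeg (ENNReal.ofReal lam * ∫⁻ y, (1 - expNeg (f y))) := by
  -- The value `0` is dropped: its level set may have infinite area, and it contributes nothing to
  -- either side.
  set S := f.range.filter (· ≠ 0) with hS
  have hsum : ∀ ω, ∑' i, f (x i ω) = ∑ c ∈ S, c * pointCount x (f ⁻¹' {c}) ω := by
    intro ω
    have h1 : ∑' i, f (x i ω) = ∫⁻ y, f y ∂(Measure.sum fun i => Measure.dirac (x i ω)) := by
      rw [lintegral_sum_measure]
      simp_rw [lintegral_dirac]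
    rw [h1, SimpleFunc.lintegral_eq_lintegral, SimpleFunc.lintegral, hS, Finset.sum_filter]
    refine Finset.sum_congr rfl fun c _ => ?_
    by_cases hc : c = 0
    · simp [hc]
    · rw [if_pos hc]; rfl
  have hint : ENNReal.ofReal lam * ∫⁻ y, (1 - expNeg (f y)) = ∑ c ∈ S,
      ENNReal.ofReal (lam * (volume (f ⁻¹' {c})).toReal) * (1 - expNeg c) := by
    have h1 : ∫⁻ y, (1 - expNeg (f y)) = ∫⁻ y, (f.map fun c => 1 - expNeg c) y := by simp
    rw [h1, SimpleFunc.lintegral_eq_lintegral, SimpleFunc.map_lintegral, Finset.mul_sum, hS,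
      Finset.sum_filter]
    refine Finset.sum_congr rfl fun c _ => ?_
    by_cases hc : c = 0
    · simp [hc, expNeg_zero]
    · rw [if_pos hc, ENNReal.ofReal_mul hlam, ENNReal.ofReal_toReal (hfin c hc)]
      ring
  rw [hint, expNeg_sum]
  simp_rw [hsum, expNeg_sum]
  have hind : iIndepFun (fun (c : S) ω => pointCount x (f ⁻¹' {(c : ℝ≥0∞)}) ω) P := by
    have h1 := hx.indep S.card (fun j => f ⁻¹' {(S.equivFin.symm j : ℝ≥0∞)})
      (fun j => f.measurableSet_fiber _) (fun i j hij => by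
        refine Disjoint.preimage _ (disjoint_singleton.mpr fun h => hij ?_)
        exact S.equivFin.symm.injective (Subtype.ext h))
    have h2 := h1.precomp S.equivFin.injective
    simpa [Function.comp_def] using h2
  have hmeas : ∀ c : ℝ≥0∞, Measurable (fun t : ℝ≥0∞ => expNeg (c * t)) := fun c =>
    measurable_expNeg.comp (measurable_const_mul c)
  have hind' := hind.comp (fun (c : S) t => expNeg (c * t)) (fun c => hmeas c)
  have h3 := lintegral_prod_eq_prod_lintegral_of_indepFun (μ := P) Finset.univ
    (fun (c : S) ω => expNeg (c * pointCount x (f ⁻¹' {(c : ℝ≥0∞)}) ω)) hind'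
    (fun c => (hmeas c).comp (measurable_pointCount hx.measurable (f.measurableSet_fiber _)))
  rw [← Finset.prod_coe_sort S fun c =>
    expNeg (ENNReal.ofReal (lam * (volume (f ⁻¹' {c})).toReal) * (1 - expNeg c))]
  simp_rw [← Finset.prod_coe_sort S fun c => expNeg (c * pointCount x (f ⁻¹' {c}) _)]
  rw [h3]
  refine Finset.prod_congr rfl fun c _ => ?_
  have hc := (Finset.mem_filter.mp c.2)
  have hctop : (c : ℝ≥0∞) ≠ ⊤ := by
    obtain ⟨y, hy⟩ := SimpleFunc.mem_range.mp hc.1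
    rw [← hy]; exact hf y
  exact lintegral_expNeg_poisson P (measurable_pointCount hx.measurable (f.measurableSet_fiber _))
    (by positivity) (hx.poisson _ (f.measurableSet_fiber _) (hfin c hc.2)) hctop

/-- The Laplace functional of a planar Poisson point process. -/
theorem IsPlanarPPP.laplace {Ω : Type*} [MeasurableSpace Ω] {P : Measure Ω}
    [IsProbabilityMeasure P] {lam : ℝ} (hlam : 0 ≤ lam) {x : ℕ → Ω → Plane}
    (hx : IsPlanarPPP P lam x) {f : Plane → ℝ≥0∞} (hf : Measurable f) :
    ∫⁻ ω, expNeg (∑' i, f (x i ω)) ∂P =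
      expNeg (ENNReal.ofReal lam * ∫⁻ y, (1 - expNeg (f y))) := by
  -- Cutting off to balls makes the nonzero level sets of the increasing approximations have finite
  -- area.
  set F : ℕ → SimpleFunc Plane ℝ≥0∞ := fun n =>
    (SimpleFunc.eapprox f n).restrict (Metric.ball 0 n) with hF
  have hFapp : ∀ n y, F n y = (Metric.ball (0 : Plane) n).indicator (SimpleFunc.eapprox f n) y :=
    fun n y => SimpleFunc.restrict_apply _ measurableSet_ball y
  have hmono : ∀ y, Monotone fun n => F n y := by
    intro y m n hmn
    simp only [hFapp]
    refine (indicator_le_indicator_of_subset (Metric.ball_subset_ball (Nat.cast_le.mpr hmn))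
      (fun _ => zero_le) y).trans ?_
    exact indicator_le_indicator (SimpleFunc.monotone_eapprox f hmn y)
  have hlim : ∀ y, Tendsto (fun n => F n y) atTop (𝓝 (f y)) := by
    intro y
    have h1 : Tendsto (fun n => SimpleFunc.eapprox f n y) atTop (𝓝 (f y)) := by
      rw [← SimpleFunc.iSup_eapprox_apply hf y]
      exact tendsto_atTop_iSup fun m n hmn => SimpleFunc.monotone_eapprox f hmn y
    refine h1.congr' ?_
    obtain ⟨N, hN⟩ := exists_nat_gt ‖y‖
    filter_upwards [eventually_ge_atTop N] with n hn
    rw [hFapp, indicator_of_mem]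
    rw [mem_ball_zero_iff]
    exact hN.trans_le (by exact_mod_cast hn)
  have hiSup : ∀ y, ⨆ n, F n y = f y := fun y =>
    tendsto_nhds_unique (tendsto_atTop_iSup (hmono y)) (hlim y)
  have hn : ∀ n, ∫⁻ ω, expNeg (∑' i, F n (x i ω)) ∂P =
      expNeg (ENNReal.ofReal lam * ∫⁻ y, (1 - expNeg (F n y))) := fun n => by
    refine hx.laplace_simpleFunc hlam (F n) (fun y => ?_) (fun c hc => ?_)
    · rw [hFapp]
      refine ne_top_of_le_ne_top (SimpleFunc.eapprox_lt_top f n y).ne (indicator_le_self _ _ y)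
    · refine ne_top_of_le_ne_top (measure_ball_lt_top (x := (0 : Plane)) (r := n)).ne
        (measure_mono fun y hy => ?_)
      by_contra hy'
      refine hc ?_
      rw [mem_preimage, mem_singleton_iff] at hy
      rw [← hy, hFapp, indicator_of_notMem hy']
  have hL : Tendsto (fun n => ∫⁻ ω, expNeg (∑' i, F n (x i ω)) ∂P) atTop
      (𝓝 (∫⁻ ω, expNeg (∑' i, f (x i ω)) ∂P)) := by
    refine tendsto_lintegral_expNeg
      (fun n => Measurable.tsum fun i => (F n).measurable.comp (hx.measurable i)) fun ω => ?_
    -- Monotone convergence for counting measure on the indices.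
    have h1 : ∑' i, f (x i ω) = ⨆ n, ∑' i, F n (x i ω) := by
      have h2 := lintegral_iSup (μ := Measure.count) (f := fun n (i : ℕ) => F n (x i ω))
        (fun n => measurable_from_nat) (fun m n hmn i => hmono _ hmn)
      simp only [hiSup, lintegral_count] at h2
      exact h2
    rw [h1]
    exact tendsto_atTop_iSup fun m n hmn => ENNReal.tsum_le_tsum fun i => hmono _ hmn
  have hR : Tendsto (fun n => expNeg (ENNReal.ofReal lam * ∫⁻ y, (1 - expNeg (F n y)))) atTop
      (𝓝 (expNeg (ENNReal.ofReal lam * ∫⁻ y, (1 - expNeg (f y))))) := by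
    refine (continuous_expNeg.tendsto _).comp
      (ENNReal.Tendsto.const_mul ?_ (Or.inr ENNReal.ofReal_ne_top))
    refine lintegral_tendsto_of_tendsto_of_monotone
      (fun n => (measurable_const.sub (measurable_expNeg.comp (F n).measurable)).aemeasurable)
      (ae_of_all _ fun y m n hmn => tsub_le_tsub_left (antitone_expNeg (hmono y hmn)) _)
      (ae_of_all _ fun y => ?_)
    exact ENNReal.Tendsto.sub tendsto_const_nhds ((continuous_expNeg.tendsto _).comp (hlim y))
      (Or.inl ENNReal.one_ne_top)
  simp_rw [hn] at hL
  exact tendsto_nhds_unique hL hR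

/-! ### Exponentially distributed gains -/

lemma lintegral_expMeasure_one (F : ℝ → ℝ≥0∞) :
    ∫⁻ u, F u ∂(expMeasure 1) = ∫⁻ u in Ioi 0, ENNReal.ofReal (Real.exp (-u)) * F u := by
  have h1 : expMeasure 1 = volume.withDensity (exponentialPDF 1) := rfl
  have hm : Measurable (exponentialPDF 1) := (measurable_exponentialPDFReal 1).ennreal_ofReal
  rw [h1, lintegral_withDensity_eq_lintegral_mul_non_measurable _ hm
    (ae_of_all _ fun u => ENNReal.ofReal_lt_top), ← lintegral_indicator measurableSet_Ioi]
  refine lintegral_congr_ae ?_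
  have h0 : ∀ᵐ u : ℝ, u ≠ 0 := by simp [ae_iff]
  filter_upwards [h0] with u hu
  rcases lt_or_gt_of_ne hu with hu | hu
  · simp [exponentialPDF_of_neg hu, hu.le]
  · simp [exponentialPDF_of_nonneg hu.le, hu]

/-- The Laplace transform of the standard exponential distribution. -/
lemma laplace_expMeasure_one {c : ℝ} (hc : 0 ≤ c) :
    ∫⁻ u, ENNReal.ofReal (Real.exp (-(c * u))) ∂(expMeasure 1) = ENNReal.ofReal (1 + c)⁻¹ := by
  rw [lintegral_expMeasure_one]
  simp_rw [← ENNReal.ofReal_mul (Real.exp_pos _).le, ← Real.exp_add]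
  have hneg : -(1 + c) < 0 := by linarith
  have h : ∀ u : ℝ, -u + -(c * u) = -(1 + c) * u := fun u => by ring
  simp_rw [h]
  rw [← ofReal_integral_eq_lintegral_ofReal (integrableOn_exp_mul_Ioi hneg 0)
    (ae_of_all _ fun u => (Real.exp_pos _).le), integral_exp_mul_Ioi hneg]
  congr 1
  rw [mul_zero, Real.exp_zero, neg_div_neg_eq, one_div]

/-- The tail of the standard exponential distribution. -/
lemma expMeasure_one_Ici (c : ℝ) :
    expMeasure 1 (Ici c) = ENNReal.ofReal (Real.exp (-max 0 c)) := by
  rw [← lintegral_indicator_one measurableSet_Ici, lintegral_expMeasure_one]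
  have h1 : ∫⁻ u in Ioi 0, ENNReal.ofReal (Real.exp (-u)) * (Ici c).indicator 1 u
      = ∫⁻ u in Ioi (max 0 c), ENNReal.ofReal (Real.exp (-1 * u)) := by
    rw [← lintegral_indicator measurableSet_Ioi, ← lintegral_indicator measurableSet_Ioi]
    refine lintegral_congr_ae ?_
    have h0 : ∀ᵐ u : ℝ, u ≠ c := by simp [ae_iff]
    filter_upwards [h0] with u hu
    have hle : c ≤ u ↔ c < u := ⟨fun h => lt_of_le_of_ne h hu.symm, le_of_lt⟩
    by_cases h : 0 < u <;> by_cases h' : c < u <;> simp [indicator, h, h', hle]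
  rw [h1, ← ofReal_integral_eq_lintegral_ofReal (integrableOn_exp_mul_Ioi (by norm_num) _)
    (ae_of_all _ fun u => (Real.exp_pos _).le), integral_exp_mul_Ioi (by norm_num)]
  simp

/-- The probability that a sum of two independent exponential variables with rates `r₁, r₂`
is at least `T`. -/
lemma expMeasure_prod_sum_ge {r₁ r₂ : ℝ} (hr₁ : 0 < r₁) (hr₂ : 0 < r₂) (T : ℝ) :
    ((expMeasure 1).prod (expMeasure 1)) {p | T ≤ p.1 / r₁ + p.2 / r₂} =
      ∫⁻ z in Ioi 0, ENNReal.ofReal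
        (r₂ * Real.exp (-(z * r₂)) * Real.exp (-(max 0 (T - z) * r₁))) := by
  have := isProbabilityMeasure_expMeasure zero_lt_one
  have hset : MeasurableSet {p : ℝ × ℝ | T ≤ p.1 / r₁ + p.2 / r₂} :=
    measurableSet_le measurable_const (by fun_prop)
  rw [Measure.prod_apply_symm hset]
  have h1 : ∀ v : ℝ, expMeasure 1 ((fun u => (u, v)) ⁻¹' {p : ℝ × ℝ | T ≤ p.1 / r₁ + p.2 / r₂})
      = ENNReal.ofReal (Real.exp (-(max 0 (T - v / r₂) * r₁))) := fun v => by
    have h2 : (fun u => (u, v)) ⁻¹' {p : ℝ × ℝ | T ≤ p.1 / r₁ + p.2 / r₂}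
        = Ici ((T - v / r₂) * r₁) := by
      ext u
      simp only [mem_preimage, mem_ofPred_eq, mem_Ici]
      rw [← le_div_iff₀ hr₁, sub_le_iff_le_add]
    rw [h2, expMeasure_one_Ici, max_mul_of_nonneg _ _ hr₁.le, zero_mul]
  simp_rw [h1]
  rw [lintegral_expMeasure_one]
  -- Substitution `v = r₂ z`: the variable becomes the value of the second branch.
  have h3 : (fun z : ℝ => r₂ * z) '' Ioi 0 = Ioi 0 := by
    rw [image_mul_left_Ioi hr₂, mul_zero]
  have h4 := lintegral_image_eq_lintegral_abs_deriv_mul (s := Ioi (0 : ℝ)) (f := fun z => r₂ * z)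
    (f' := fun _ => r₂) measurableSet_Ioi
    (fun z _ => by simpa using ((hasDerivAt_id z).const_mul r₂).hasDerivWithinAt)
    (fun a _ b _ hab => mul_left_cancel₀ hr₂.ne' hab)
    (fun v => ENNReal.ofReal (Real.exp (-v)) *
      ENNReal.ofReal (Real.exp (-(max 0 (T - v / r₂) * r₁))))
  rw [h3] at h4
  rw [h4]
  refine lintegral_congr fun z => ?_
  rw [abs_of_pos hr₂, ← ENNReal.ofReal_mul (by positivity), ← ENNReal.ofReal_mul (by positivity),
    mul_div_cancel_left₀ _ hr₂.ne', mul_comm z r₂, mul_assoc]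

/-! ### The area integral for path loss exponent four -/

/-- One partial fraction of the radial integrand. The case `p = 0` is harmless, since both sides
then vanish; it is needed when `(T - z)⁺ = 0`. -/
lemma hasDerivAt_cube_mul_arctan {p r : ℝ} (hr : 0 < r) :
    HasDerivAt (fun r => p ^ 3 * Real.arctan (r ^ 2 / p)) (p ^ 4 * (2 * r) / (r ^ 4 + p ^ 2)) r := by
  have h := (((hasDerivAt_pow 2 r).div_const p).arctan).const_mul (p ^ 3)
  refine h.congr_deriv ?_
  rcases eq_or_ne p 0 with rfl | hp
  · simp
  · have : r ^ 4 + p ^ 2 ≠ 0 := by positivity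
    have : 1 + (r ^ 2 / p) ^ 2 ≠ 0 := by positivity
    field_simp
    push_cast
    ring

/-- The radial integral of the interference Laplace exponent. -/
lemma radial_integral {p q : ℝ} (hp : 0 ≤ p) (hq : 0 ≤ q) (hpq : p ≠ q) :
    IntegrableOn (fun r : ℝ => r * (1 - ((1 + p ^ 2 * r⁻¹ ^ 4) * (1 + q ^ 2 * r⁻¹ ^ 4))⁻¹))
      (Ioi 0) ∧
    ∫ r in Ioi (0 : ℝ), r * (1 - ((1 + p ^ 2 * r⁻¹ ^ 4) * (1 + q ^ 2 * r⁻¹ ^ 4))⁻¹) =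
      Real.pi / 4 * ((p ^ 3 - q ^ 3) / (p ^ 2 - q ^ 2)) := by
  have hne : p ^ 2 - q ^ 2 ≠ 0 := fun h => hpq ((sq_eq_sq₀ hp hq).mp (by linarith))
  -- With `A = p²`, `B = q²`, the primitive comes from `1 - r⁸ / ((r⁴ + A)(r⁴ + B)) = (A² / (r⁴ + A)
  -- - B² / (r⁴ + B)) / (A - B)`.
  set G : ℝ → ℝ := fun r => (p ^ 3 * Real.arctan (r ^ 2 / p) - q ^ 3 * Real.arctan (r ^ 2 / q)) /
    (2 * (p ^ 2 - q ^ 2)) with hG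
  have hderiv : ∀ r ∈ Ioi (0 : ℝ), HasDerivAt G
      (r * (1 - ((1 + p ^ 2 * r⁻¹ ^ 4) * (1 + q ^ 2 * r⁻¹ ^ 4))⁻¹)) r := by
    intro r hr
    have hr : 0 < r := hr
    have h := ((hasDerivAt_cube_mul_arctan (p := p) hr).sub
      (hasDerivAt_cube_mul_arctan (p := q) hr)).div_const (2 * (p ^ 2 - q ^ 2))
    refine h.congr_deriv ?_
    have h1 : r ^ 4 + p ^ 2 ≠ 0 := by positivity
    have h2 : r ^ 4 + q ^ 2 ≠ 0 := by positivity
    have e1 : 1 + p ^ 2 * r⁻¹ ^ 4 = (r ^ 4 + p ^ 2) / r ^ 4 := by field_simp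
    have e2 : 1 + q ^ 2 * r⁻¹ ^ 4 = (r ^ 4 + q ^ 2) / r ^ 4 := by field_simp
    rw [e1, e2]
    field_simp
    ring
  have hnonneg : ∀ r ∈ Ioi (0 : ℝ),
      0 ≤ r * (1 - ((1 + p ^ 2 * r⁻¹ ^ 4) * (1 + q ^ 2 * r⁻¹ ^ 4))⁻¹) := by
    intro r hr
    have hr : 0 < r := hr
    refine mul_nonneg hr.le (sub_nonneg.mpr (inv_le_one_of_one_le₀ ?_))
    exact one_le_mul_of_one_le_of_one_le (by linarith [show 0 ≤ p ^ 2 * r⁻¹ ^ 4 by positivity])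
      (by linarith [show 0 ≤ q ^ 2 * r⁻¹ ^ 4 by positivity])
  have hcont : ContinuousWithinAt G (Ici 0) 0 := by
    refine Continuous.continuousWithinAt ?_
    simp only [hG]
    have : ∀ p : ℝ, Continuous fun r : ℝ => Real.arctan (r ^ 2 / p) := fun p =>
      Real.continuous_arctan.comp (by fun_prop)
    exact (((this p).const_mul _).sub ((this q).const_mul _)).div_const _
  have hat : ∀ p : ℝ, 0 ≤ p →
      Tendsto (fun r : ℝ => p ^ 3 * Real.arctan (r ^ 2 / p)) atTop (𝓝 (p ^ 3 * (Real.pi / 2))) := by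
    intro p hp
    rcases hp.eq_or_lt with rfl | hp
    · simp
    · refine Tendsto.const_mul _ ((tendsto_nhds_of_tendsto_nhdsWithin
        Real.tendsto_arctan_atTop).comp ?_)
      exact (tendsto_pow_atTop two_ne_zero).atTop_div_const hp
  have hlim := ((hat p hp).sub (hat q hq)).div_const (2 * (p ^ 2 - q ^ 2))
  refine ⟨integrableOn_Ioi_deriv_of_nonneg hcont hderiv hnonneg hlim, ?_⟩
  rw [integral_Ioi_of_hasDerivAt_of_nonneg hcont hderiv hnonneg hlim]
  simp only [hG]
  simp
  field_simp
  ring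

/-- The area integral of the Laplace exponent for path loss exponent four. -/
lemma lintegral_plane_laplace {a b d : ℝ} (ha : 0 ≤ a) (hb : 0 ≤ b) (hab : a ≠ b) (hd : 0 < d) :
    ∫⁻ y : Plane, (1 - ENNReal.ofReal
        ((1 + a * (d ^ 4 * ‖y‖⁻¹ ^ 4)) * (1 + b * (d ^ 4 * ‖y‖⁻¹ ^ 4)))⁻¹) =
      ENNReal.ofReal (Real.pi ^ 2 * d ^ 2 / 2 *
        ((a ^ (3 / 2 : ℝ) - b ^ (3 / 2 : ℝ)) / (a - b))) := by
  have hpow : ∀ a : ℝ, 0 ≤ a → (√a * d ^ 2) ^ 2 = a * d ^ 4 := fun a ha => by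
    rw [mul_pow, Real.sq_sqrt ha]; ring
  have hpow3 : ∀ a : ℝ, 0 ≤ a → (√a * d ^ 2) ^ 3 = a ^ (3 / 2 : ℝ) * d ^ 6 := fun a ha => by
    rw [mul_pow, Real.sqrt_eq_rpow, ← Real.rpow_natCast (a ^ (1 / 2 : ℝ)), ← Real.rpow_mul ha]
    rw [← pow_mul]
    norm_num
  have hne : √a * d ^ 2 ≠ √b * d ^ 2 := fun h => hab
    ((Real.sqrt_inj ha hb).mp (mul_right_cancel₀ (by positivity) h))
  -- Chosen so that `p² = a d⁴`; the cubes `p³` are then the source of the exponent `3 / 2`.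
  obtain ⟨hint, hval⟩ := radial_integral (p := √a * d ^ 2) (q := √b * d ^ 2) (by positivity)
    (by positivity) hne
  rw [hpow a ha, hpow b hb] at hval
  rw [hpow3 a ha, hpow3 b hb] at hval
  simp only [hpow a ha, hpow b hb] at hint
  set φ : ℝ → ℝ := fun r => 1 - ((1 + a * d ^ 4 * r⁻¹ ^ 4) * (1 + b * d ^ 4 * r⁻¹ ^ 4))⁻¹ with hφ
  have hfin : Module.finrank ℝ Plane = 2 := by simp
  have hI : Integrable (fun y : Plane => φ ‖y‖) := by
    rw [integrable_fun_norm_addHaar, hfin]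
    simpa only [Nat.add_one_sub_one, pow_one, smul_eq_mul] using hint
  have hnonneg : ∀ y : Plane, 0 ≤ φ ‖y‖ := fun y => by
    refine sub_nonneg.mpr (inv_le_one_of_one_le₀ ?_)
    exact one_le_mul_of_one_le_of_one_le
      (by linarith [show 0 ≤ a * d ^ 4 * ‖y‖⁻¹ ^ 4 by positivity])
      (by linarith [show 0 ≤ b * d ^ 4 * ‖y‖⁻¹ ^ 4 by positivity])
  have h1 : ∀ y : Plane, 1 - ENNReal.ofReal
      ((1 + a * (d ^ 4 * ‖y‖⁻¹ ^ 4)) * (1 + b * (d ^ 4 * ‖y‖⁻¹ ^ 4)))⁻¹ =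
      ENNReal.ofReal (φ ‖y‖) := fun y => by
    rw [← ENNReal.ofReal_one, ← ENNReal.ofReal_sub _ (by positivity)]
    simp only [hφ, mul_assoc]
  simp_rw [h1]
  rw [← ofReal_integral_eq_lintegral_ofReal hI (ae_of_all _ hnonneg),
    integral_fun_norm_addHaar volume φ, hfin, Measure.real, EuclideanSpace.volume_ball_fin_two]
  congr 1
  simp only [hφ, smul_eq_mul, Nat.add_one_sub_one, pow_one, hval]
  have : a - b ≠ 0 := sub_ne_zero.mpr hab
  have : a * d ^ 4 - b * d ^ 4 ≠ 0 := by rw [← sub_mul]; positivity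
  simp [Real.pi_pos.le]
  field_simp
  ring

/-! ### Independence and conditioning -/

section Independence

variable {Ω α β γ : Type*} [MeasurableSpace Ω] [MeasurableSpace α] [MeasurableSpace β]
  [MeasurableSpace γ] {P : Measure Ω} [IsProbabilityMeasure P]

lemma lintegral_comp_prodMk_of_indepFun {X : Ω → α} {Y : Ω → β} (h : IndepFun X Y P)
    (hX : Measurable X) (hY : Measurable Y) {F : α × β → ℝ≥0∞} (hF : Measurable F) :
    ∫⁻ ω, F (X ω, Y ω) ∂P = ∫⁻ ω, ∫⁻ u, F (X ω, u) ∂(P.map Y) ∂P := by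
  have := Measure.isProbabilityMeasure_map (μ := P) hY.aemeasurable
  have h1 : ∫⁻ ω, F (X ω, Y ω) ∂P = ∫⁻ p, F p ∂(P.map fun ω => (X ω, Y ω)) :=
    (lintegral_map hF (hX.prodMk hY)).symm
  rw [h1, (indepFun_iff_map_prod_eq_prod_map_map hX.aemeasurable hY.aemeasurable).mp h,
    lintegral_prod _ hF.aemeasurable, lintegral_map (Measurable.lintegral_prod_right' hF) hX]

/-- The joint law is a threefold product, and product measures are associative. -/
lemma indepFun_prodMk_left {X : Ω → α} {Y : Ω → β} {Z : Ω → γ}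
    (h : IndepFun X (fun ω => (Y ω, Z ω)) P) (h' : IndepFun Y Z P)
    (hX : Measurable X) (hY : Measurable Y) (hZ : Measurable Z) :
    IndepFun (fun ω => (X ω, Y ω)) Z P := by
  have := Measure.isProbabilityMeasure_map (μ := P) hX.aemeasurable
  have := Measure.isProbabilityMeasure_map (μ := P) hY.aemeasurable
  have := Measure.isProbabilityMeasure_map (μ := P) hZ.aemeasurable
  have hXY : IndepFun X Y P := h.comp measurable_id measurable_fst
  rw [indepFun_iff_map_prod_eq_prod_map_map (hX.prodMk hY).aemeasurable hZ.aemeasurable,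
    (indepFun_iff_map_prod_eq_prod_map_map hX.aemeasurable hY.aemeasurable).mp hXY,
    ← (MeasurableEquiv.prodAssoc (α := α) (β := β) (γ := γ)).map_measurableEquiv_injective.eq_iff,
    Measure.prodAssoc_prod,
    ← (indepFun_iff_map_prod_eq_prod_map_map hY.aemeasurable hZ.aemeasurable).mp h',
    ← (indepFun_iff_map_prod_eq_prod_map_map hX.aemeasurable (hY.prodMk hZ).aemeasurable).mp h,
    Measure.map_map (MeasurableEquiv.measurable _) ((hX.prodMk hY).prodMk hZ)]
  rfl

end Independence

lemma indepFun_sumElim {Ω ι κ : Type*} [MeasurableSpace Ω] {P : Measure Ω}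
    {f : ι → Ω → ℝ} {g : κ → Ω → ℝ} (h : iIndepFun (Sum.elim f g : ι ⊕ κ → Ω → ℝ) P) (hf : ∀ i, Measurable (f i))
    (hg : ∀ i, Measurable (g i)) :
    IndepFun (fun ω i => f i ω) (fun ω i => g i ω) P := by
  have hm : ∀ j, Measurable ((Sum.elim f g : ι ⊕ κ → Ω → ℝ) j) := by
    rintro (j | j)
    · exact hf j
    · exact hg j
  have h1 := indep_iSup_of_disjoint (fun j => (hm j).comap_le) h.iIndep
    (S := range Sum.inl) (T := range Sum.inr) isCompl_range_inl_range_inr.disjoint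
  rw [iSup_range, iSup_range] at h1
  rw [IndepFun_iff_Indep]
  simpa [MeasurableSpace.pi, MeasurableSpace.comap_iSup, MeasurableSpace.comap_comp,
    Function.comp_def] using h1

lemma ae_expMeasure_one_nonneg : ∀ᵐ u ∂(expMeasure 1), 0 ≤ u := by
  have := isProbabilityMeasure_expMeasure zero_lt_one
  have h := expMeasure_one_Ici 0
  rw [max_self, neg_zero, Real.exp_zero, ENNReal.ofReal_one,
    ← prob_compl_eq_zero_iff measurableSet_Ici] at h
  exact h

lemma laplace_expMeasure_one' {c : ℝ} (hc : 0 ≤ c) :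
    ∫⁻ u, expNeg (ENNReal.ofReal c * ENNReal.ofReal u) ∂(expMeasure 1) =
      ENNReal.ofReal (1 + c)⁻¹ := by
  rw [← laplace_expMeasure_one hc]
  refine lintegral_congr_ae ?_
  filter_upwards [ae_expMeasure_one_nonneg] with u hu
  rw [← ENNReal.ofReal_mul hc, expNeg_ofReal (by positivity)]

/-- For `b > 0` the variable `exp(-b I)` vanishes where `I = ⊤`, so its mean is at most `P (I ≠ ⊤)`;
these means tend to `1` as `b → 0`. -/
lemma ae_ne_top_of_laplace {Ω : Type*} [MeasurableSpace Ω] {P : Measure Ω}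
    [IsProbabilityMeasure P] {I : Ω → ℝ≥0∞} (hI : Measurable I) {C : ℝ}
    (h : ∀ b : ℝ, 0 < b → ∫⁻ ω, expNeg (ENNReal.ofReal b * I ω) ∂P =
      ENNReal.ofReal (Real.exp (-(C * √b)))) : ∀ᵐ ω ∂P, I ω ≠ ⊤ := by
  have hmeas : MeasurableSet {ω | I ω ≠ ⊤} := (hI (measurableSet_singleton ⊤)).compl
  have hle : ∀ b : ℝ, 0 < b → ENNReal.ofReal (Real.exp (-(C * √b))) ≤ P {ω | I ω ≠ ⊤} := by
    intro b hb
    rw [← h b hb, ← lintegral_indicator_one hmeas]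
    refine lintegral_mono fun ω => ?_
    by_cases hω : I ω = ⊤
    · rw [hω, ENNReal.mul_top (by simpa using hb), expNeg_top]; exact zero_le
    · rw [indicator_of_mem (by exact hω)]; exact expNeg_le_one _
  have hlim : Tendsto (fun b : ℝ => ENNReal.ofReal (Real.exp (-(C * √b)))) (𝓝[>] 0)
      (𝓝 1) := by
    have hc : Continuous fun b : ℝ => ENNReal.ofReal (Real.exp (-(C * √b))) :=
      ENNReal.continuous_ofReal.comp (by fun_prop)
    have := (hc.tendsto 0).mono_left (nhdsWithin_le_nhds (s := Ioi 0))
    simpa using this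
  have h1 : 1 ≤ P {ω | I ω ≠ ⊤} :=
    le_of_tendsto hlim (by filter_upwards [self_mem_nhdsWithin] with b hb using hle b hb)
  have h2 := le_antisymm prob_le_one h1
  rw [← prob_compl_eq_zero_iff hmeas] at h2
  exact h2

/-- The origin has area zero, so its count is Poisson with mean zero. It must be avoided because
there `‖x‖ ^ (-4)` is `⊤` in `[0, ∞]`, while the real `pathGain` is `0`. -/
lemma IsPlanarPPP.ae_ne_zero {Ω : Type*} [MeasurableSpace Ω] {P : Measure Ω}
    [IsProbabilityMeasure P] {lam : ℝ} {x : ℕ → Ω → Plane} (hx : IsPlanarPPP P lam x) :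
    ∀ᵐ ω ∂P, ∀ i, x i ω ≠ 0 := by
  have h := hx.poisson {0} (measurableSet_singleton 0) (by simp) 0
  simp only [Nat.cast_zero, measure_singleton, ENNReal.toReal_zero, mul_zero, neg_zero,
    Real.exp_zero, pow_zero, mul_one, Nat.factorial_zero, Nat.cast_one, div_one,
    ENNReal.ofReal_one] at h
  have hmeas : MeasurableSet {ω | pointCount x {0} ω = 0} :=
    measurable_pointCount hx.measurable (measurableSet_singleton 0) (measurableSet_singleton 0)
  rw [← prob_compl_eq_zero_iff hmeas] at h
  have h' : ∀ᵐ ω ∂P, pointCount x {0} ω = 0 := h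
  filter_upwards [h'] with ω hω i hi
  rw [pointCount, Measure.sum_apply _ (measurableSet_singleton _), ENNReal.tsum_eq_zero] at hω
  have := hω i
  rw [Measure.dirac_apply' _ (measurableSet_singleton _), hi] at this
  simp at this

/-! ### Joint Laplace transform of the interference -/

/-- Interference power as a function of the points and the gains. -/
noncomputable def interferenceFun (d : ℝ) (x : ℕ → Plane) (h : ℕ → ℝ) : ℝ≥0∞ :=
  ENNReal.ofReal (d ^ (4 : ℝ)) *
    ∑' i, ENNReal.ofReal (h i) * (ENNReal.ofReal ‖x i‖) ^ (-4 : ℝ)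

lemma measurable_interferenceFun (d : ℝ) :
    Measurable fun p : (ℕ → Plane) × (ℕ → ℝ) => interferenceFun d p.1 p.2 := by
  unfold interferenceFun
  refine (Measurable.tsum fun i => ?_).const_mul _
  fun_prop

/-- The path gain `d ^ 4 * r ^ (-4)`. -/
noncomputable def pathGain (d r : ℝ) : ℝ := d ^ 4 * r⁻¹ ^ 4

lemma pathGain_nonneg (d r : ℝ) : 0 ≤ pathGain d r := by unfold pathGain; positivity

lemma ofReal_pathGain {d r : ℝ} (hr : 0 < r) :
    ENNReal.ofReal (pathGain d r) =
      ENNReal.ofReal (d ^ (4 : ℝ)) * (ENNReal.ofReal r) ^ (-4 : ℝ) := by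
  rw [ENNReal.ofReal_rpow_of_pos hr, ← ENNReal.ofReal_mul' (by positivity), pathGain,
    Real.rpow_neg hr.le]
  norm_num

/-- The Laplace transform of the interference at fixed interferer locations. -/
lemma laplace_interferenceFun {Ω : Type*} [MeasurableSpace Ω] {P : Measure Ω}
    [IsProbabilityMeasure P] {N : ℕ} {h : Fin N → ℕ → Ω → ℝ} (hm : ∀ n i, Measurable (h n i))
    (hlaw : ∀ n i, P.map (h n i) = expMeasure 1)
    (hind : iIndepFun (fun p : Fin N × ℕ => h p.1 p.2) P) (d : ℝ) {a : Fin N → ℝ}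
    (ha : ∀ n, 0 ≤ a n) {x : ℕ → Plane} (hx : ∀ i, x i ≠ 0) :
    ∫⁻ ω, expNeg (∑ n, ENNReal.ofReal (a n) * interferenceFun d x fun i => h n i ω) ∂P =
      expNeg (∑' i, ENNReal.ofReal (Real.log (∏ n, (1 + a n * pathGain d ‖x i‖)))) := by
  set c : Fin N × ℕ → ℝ := fun p => a p.1 * pathGain d ‖x p.2‖ with hc
  have hc0 : ∀ p, 0 ≤ c p := fun p => mul_nonneg (ha _) (pathGain_nonneg _ _)
  have hpos : ∀ i, 1 ≤ ∏ n, (1 + a n * pathGain d ‖x i‖) := fun i =>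
    Finset.one_le_prod fun n _ => by linarith [hc0 (n, i)]
  have hsum : ∀ ω, ∑ n, ENNReal.ofReal (a n) * interferenceFun d x (fun i => h n i ω) =
      ∑' i, ∑ n, ENNReal.ofReal (c (n, i)) * ENNReal.ofReal (h n i ω) := fun ω => by
    rw [Summable.tsum_finsetSum fun n _ => ENNReal.summable]
    refine Finset.sum_congr rfl fun n _ => ?_
    rw [interferenceFun, ← ENNReal.tsum_mul_left, ← ENNReal.tsum_mul_left]
    refine tsum_congr fun i => ?_
    rw [hc, ENNReal.ofReal_mul (ha n), ofReal_pathGain (norm_pos_iff.mpr (hx i))]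
    ring
  simp_rw [hsum]
  -- Independence factorises the mean over finitely many interferers; the limit in `k` follows by
  -- dominated convergence. Writing the product as `expNeg` of a sum of logarithms gives it the
  -- shape required by the Laplace functional.
  have hfin : ∀ k : ℕ, ∫⁻ ω, expNeg (∑ i ∈ Finset.range k, ∑ n,
      ENNReal.ofReal (c (n, i)) * ENNReal.ofReal (h n i ω)) ∂P = expNeg (∑ i ∈ Finset.range k,
        ENNReal.ofReal (Real.log (∏ n, (1 + a n * pathGain d ‖x i‖)))) := fun k => by
    have hφ : ∀ p, Measurable fun u : ℝ => expNeg (ENNReal.ofReal (c p) * ENNReal.ofReal u) :=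
      fun p => measurable_expNeg.comp (by fun_prop)
    have h1 := lintegral_prod_eq_prod_lintegral_of_indepFun (μ := P)
      (Finset.range k ×ˢ (Finset.univ : Finset (Fin N)) |>.map (Equiv.prodComm _ _).toEmbedding)
      (fun p ω => expNeg (ENNReal.ofReal (c p) * ENNReal.ofReal (h p.1 p.2 ω)))
      (hind.comp (fun p u => expNeg (ENNReal.ofReal (c p) * ENNReal.ofReal u)) hφ)
      (fun p => (hφ p).comp (hm _ _))
    simp only [Finset.prod_map, Finset.prod_product, Equiv.coe_toEmbedding, Equiv.prodComm_apply,
      Prod.swap] at h1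
    simp_rw [expNeg_sum]
    rw [h1]
    refine Finset.prod_congr rfl fun i _ => ?_
    rw [expNeg_ofReal (Real.log_nonneg (hpos i)), Real.exp_neg,
      Real.exp_log (zero_lt_one.trans_le (hpos i)), ← Finset.prod_inv_distrib,
      ENNReal.ofReal_prod_of_nonneg fun n _ =>
        inv_nonneg.mpr (add_nonneg zero_le_one (hc0 (n, i)))]
    refine Finset.prod_congr rfl fun n _ => ?_
    rw [← lintegral_map (hφ (n, i)) (hm n i), hlaw, laplace_expMeasure_one' (hc0 _)]
  have hL := tendsto_lintegral_expNeg (μ := P)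
    (F := fun k ω => ∑ i ∈ Finset.range k, ∑ n,
      ENNReal.ofReal (c (n, i)) * ENNReal.ofReal (h n i ω))
    (fun k => Finset.measurable_sum _ fun i _ => Finset.measurable_sum _ fun n _ =>
      (hm n i).ennreal_ofReal.const_mul _)
    (fun ω => ENNReal.tendsto_nat_tsum _)
  simp_rw [hfin] at hL
  exact tendsto_nhds_unique hL ((continuous_expNeg.tendsto _).comp (ENNReal.tendsto_nat_tsum _))

lemma measurable_ofReal_mul_exp_mul_exp {α : Type*} [MeasurableSpace α] {I₀ I₁ ζ : α → ℝ}
    (h₀ : Measurable I₀) (h₁ : Measurable I₁) (hζ : Measurable ζ) (T c : ℝ) :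
    Measurable fun u => ENNReal.ofReal ((I₁ u + c) * Real.exp (-(ζ u * (I₁ u + c))) *
      Real.exp (-(max 0 (T - ζ u) * (I₀ u + c)))) := by
  fun_prop

namespace IsNakagamiNetwork

variable {Ω : Type*} [MeasurableSpace Ω] {P : Measure Ω} {lam d SNR : ℝ} {x : ℕ → Ω → Plane}

lemma measurable_points {N mD : ℕ} {mI : ℝ} {g : Fin N → Ω → ℝ} {h : Fin N → ℕ → Ω → ℝ}
    (hM : IsNakagamiNetwork P N lam mD mI x g h) : Measurable fun ω (i : ℕ) => x i ω :=
  measurable_pi_lambda _ hM.ppp.measurable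

lemma measurable_interference {N mD : ℕ} {mI : ℝ} {g : Fin N → Ω → ℝ} {h : Fin N → ℕ → Ω → ℝ}
    (hM : IsNakagamiNetwork P N lam mD mI x g h) (n : Fin N) :
    Measurable (interference d 4 x (h n)) :=
  (measurable_interferenceFun d).comp
    (hM.measurable_points.prodMk (measurable_pi_lambda _ (hM.measurable_h n)))

variable [IsProbabilityMeasure P]

/-- The joint Laplace transform of the interference powers under Rayleigh fading. -/
lemma laplace_interference {N mD : ℕ} {g : Fin N → Ω → ℝ} {h : Fin N → ℕ → Ω → ℝ}
    (hM : IsNakagamiNetwork P N lam mD 1 x g h) (hlam : 0 ≤ lam) {a : Fin N → ℝ}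
    (ha : ∀ n, 0 ≤ a n) :
    ∫⁻ ω, expNeg (∑ n, ENNReal.ofReal (a n) * interference d 4 x (h n) ω) ∂P =
      expNeg (ENNReal.ofReal lam * ∫⁻ y : Plane,
        (1 - ENNReal.ofReal (∏ n, (1 + a n * pathGain d ‖y‖))⁻¹)) := by
  have hHm : Measurable fun ω (p : Fin N × ℕ) => h p.1 p.2 ω :=
    measurable_pi_lambda _ fun p => hM.measurable_h _ _
  have hind : IndepFun (fun ω (i : ℕ) => x i ω) (fun ω (p : Fin N × ℕ) => h p.1 p.2 ω) P :=
    hM.indep_points.comp measurable_id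
      (measurable_pi_lambda _ fun p => measurable_pi_apply (Sum.inr p))
  have hindh : iIndepFun (fun p : Fin N × ℕ => h p.1 p.2) P :=
    hM.indep_gains.precomp Sum.inr_injective
  have hF : Measurable fun p : (ℕ → Plane) × (Fin N × ℕ → ℝ) =>
      expNeg (∑ n, ENNReal.ofReal (a n) * interferenceFun d p.1 fun i => p.2 (n, i)) := by
    refine measurable_expNeg.comp (Finset.measurable_sum _ fun n _ => Measurable.const_mul ?_ _)
    exact (measurable_interferenceFun d).comp (measurable_fst.prodMk
      (measurable_pi_lambda _ fun i => (measurable_pi_apply _).comp measurable_snd))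
  have h1 := lintegral_comp_prodMk_of_indepFun hind hM.measurable_points hHm hF
  have h2 : ∀ᵐ ω ∂P, ∫⁻ u, expNeg (∑ n, ENNReal.ofReal (a n) *
      interferenceFun d (fun i => x i ω) fun i => u (n, i))
        ∂(P.map fun ω (p : Fin N × ℕ) => h p.1 p.2 ω) =
      expNeg (∑' i, ENNReal.ofReal (Real.log (∏ n, (1 + a n * pathGain d ‖x i ω‖)))) := by
    filter_upwards [hM.ppp.ae_ne_zero] with ω hω
    refine (lintegral_map (hF.comp measurable_prodMk_left) hHm).trans ?_
    exact laplace_interferenceFun hM.measurable_h hM.law_h hindh d ha hω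
  have h3 : Measurable fun y : Plane =>
      ENNReal.ofReal (Real.log (∏ n, (1 + a n * pathGain d ‖y‖))) := by
    unfold pathGain
    exact (Real.measurable_log.comp (Finset.measurable_prod _ fun n _ => by fun_prop)).ennreal_ofReal
  -- Average over the gains at frozen points, then over the points.
  calc _ = _ := h1
    _ = _ := lintegral_congr_ae h2
    _ = _ := hM.ppp.laplace hlam h3
    _ = _ := by
      congr 2
      refine lintegral_congr fun y => ?_
      have hpos : 1 ≤ ∏ n, (1 + a n * pathGain d ‖y‖) := Finset.one_le_prod fun n _ => by
        linarith [mul_nonneg (ha n) (pathGain_nonneg d ‖y‖)]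
      rw [expNeg_ofReal (Real.log_nonneg hpos), Real.exp_neg,
        Real.exp_log (zero_lt_one.trans_le hpos)]

variable {mD : ℕ} {g : Fin 2 → Ω → ℝ} {h : Fin 2 → ℕ → Ω → ℝ}

/-- The joint Laplace transform of the interference powers at two antennas. -/
lemma laplace_interference_two (hM : IsNakagamiNetwork P 2 lam mD 1 x g h) (hlam : 0 ≤ lam)
    (hd : 0 < d) {a b : ℝ} (ha : 0 ≤ a) (hb : 0 ≤ b) (hab : a ≠ b) :
    ∫⁻ ω, expNeg (ENNReal.ofReal a * interference d 4 x (h 0) ω +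
        ENNReal.ofReal b * interference d 4 x (h 1) ω) ∂P =
      ENNReal.ofReal (Real.exp (-(lam * Real.pi ^ 2 * d ^ 2 / 2 *
        ((a ^ (3 / 2 : ℝ) - b ^ (3 / 2 : ℝ)) / (a - b))))) := by
  have hab' : ∀ n, 0 ≤ (![a, b] : Fin 2 → ℝ) n := by
    intro n; fin_cases n
    · exact ha
    · exact hb
  have h1 := hM.laplace_interference (d := d) hlam hab'
  simp only [Fin.sum_univ_two, Fin.prod_univ_two, Matrix.cons_val_zero, Matrix.cons_val_one,
    pathGain] at h1
  have hK : 0 ≤ (a ^ (3 / 2 : ℝ) - b ^ (3 / 2 : ℝ)) / (a - b) := by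
    rcases le_total a b with hle | hle
    · exact div_nonneg_of_nonpos
        (sub_nonpos.mpr (Real.rpow_le_rpow ha hle (by norm_num))) (by linarith)
    · exact div_nonneg (sub_nonneg.mpr (Real.rpow_le_rpow hb hle (by norm_num))) (by linarith)
  rw [h1, lintegral_plane_laplace ha hb hab hd, ← ENNReal.ofReal_mul hlam,
    expNeg_ofReal (by positivity)]
  congr 3
  ring

/-- Putting one of the two arguments equal to `0` leaves the marginal transform, with exponent
proportional to `b ^ (3 / 2) / b = √b`. -/
lemma ae_interference_ne_top (hM : IsNakagamiNetwork P 2 lam mD 1 x g h) (hlam : 0 ≤ lam)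
    (hd : 0 < d) : ∀ᵐ ω ∂P, ∀ n, interference d 4 x (h n) ω ≠ ⊤ := by
  have hK : ∀ b : ℝ, 0 < b → b ^ (3 / 2 : ℝ) / b = √b := fun b hb => by
    rw [Real.sqrt_eq_rpow, div_eq_iff hb.ne']
    nth_rw 3 [← Real.rpow_one b]
    rw [← Real.rpow_add hb]
    norm_num
  have h0 : (0 : ℝ) ^ (3 / 2 : ℝ) = 0 := Real.zero_rpow (by norm_num)
  refine ae_all_iff.mpr fun n => ae_ne_top_of_laplace (hM.measurable_interference n)
    (C := lam * Real.pi ^ 2 * d ^ 2 / 2) fun b hb => ?_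
  fin_cases n
  · have h1 := hM.laplace_interference_two hlam hd hb.le le_rfl hb.ne'
    simpa [h0, hK b hb] using h1
  · have h1 := hM.laplace_interference_two hlam hd le_rfl hb.le hb.ne
    simpa [h0, neg_div_neg_eq, hK b hb] using h1

/-- The joint Laplace transform of the interference powers at two antennas, for the real valued
interference powers. -/
lemma integral_exp_interference (hM : IsNakagamiNetwork P 2 lam mD 1 x g h) (hlam : 0 ≤ lam)
    (hd : 0 < d) {a b : ℝ} (ha : 0 ≤ a) (hb : 0 ≤ b) (hab : a ≠ b) :
    ∫ ω, Real.exp (-(a * (interference d 4 x (h 0) ω).toReal +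
        b * (interference d 4 x (h 1) ω).toReal)) ∂P =
      Real.exp (-(lam * Real.pi ^ 2 * d ^ 2 / 2 *
        ((a ^ (3 / 2 : ℝ) - b ^ (3 / 2 : ℝ)) / (a - b)))) := by
  have hm0 := (hM.measurable_interference (d := d) 0).ennreal_toReal
  have hm1 := (hM.measurable_interference (d := d) 1).ennreal_toReal
  rw [integral_eq_lintegral_of_nonneg_ae (ae_of_all _ fun ω => (Real.exp_pos _).le)
    (by fun_prop), ← ENNReal.toReal_ofReal (Real.exp_pos (-(lam * Real.pi ^ 2 * d ^ 2 / 2 *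
        ((a ^ (3 / 2 : ℝ) - b ^ (3 / 2 : ℝ)) / (a - b))))).le,
    ← hM.laplace_interference_two hlam hd ha hb hab]
  congr 1
  refine lintegral_congr_ae ?_
  filter_upwards [hM.ae_interference_ne_top hlam hd] with ω hω
  conv_rhs => rw [← ENNReal.ofReal_toReal (hω 0), ← ENNReal.ofReal_toReal (hω 1)]
  rw [← ENNReal.ofReal_mul ha, ← ENNReal.ofReal_mul hb, ← ENNReal.ofReal_add (by positivity)
    (by positivity), expNeg_ofReal (by positivity)]

/-! ### Success probability conditional on the interference -/

/-- The success probability before averaging over the interference. -/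
lemma measure_sinrMRC_ge (hM : IsNakagamiNetwork P 2 lam 1 1 x g h) (hlam : 0 ≤ lam)
    (hd : 0 < d) (hSNR : 0 < SNR) {T : ℝ} :
    P {ω | ENNReal.ofReal T ≤ sinrMRC d 4 SNR x g h ω} =
      ∫⁻ z in Ioi 0, ∫⁻ ω, ENNReal.ofReal
        (((interference d 4 x (h 1) ω).toReal + SNR⁻¹) *
          Real.exp (-(z * ((interference d 4 x (h 1) ω).toReal + SNR⁻¹))) *
          Real.exp (-(max 0 (T - z) * ((interference d 4 x (h 0) ω).toReal + SNR⁻¹)))) ∂P := by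
  have := isProbabilityMeasure_expMeasure zero_lt_one
  have hHm : Measurable fun ω (p : Fin 2 × ℕ) => h p.1 p.2 ω :=
    measurable_pi_lambda _ fun p => hM.measurable_h _ _
  have hGm : Measurable fun ω => (g 0 ω, g 1 ω) := (hM.measurable_g 0).prodMk (hM.measurable_g 1)
  have hind : IndepFun (fun ω => ((fun i => x i ω), fun p : Fin 2 × ℕ => h p.1 p.2 ω))
      (fun ω => (g 0 ω, g 1 ω)) P := by
    refine indepFun_prodMk_left ?_ ?_ hM.measurable_points hHm hGm
    · exact hM.indep_points.comp measurable_id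
        (ψ := fun v => ((fun p => v (Sum.inr p)), (v (Sum.inl 0), v (Sum.inl 1)))) (by fun_prop)
    · exact (indepFun_sumElim hM.indep_gains hM.measurable_g
        fun p => hM.measurable_h p.1 p.2).symm.comp measurable_id
        (ψ := fun v : Fin 2 → ℝ => (v 0, v 1)) (by fun_prop)
  have hlaw : ∀ n, P.map (g n) = expMeasure 1 := fun n => by
    rw [hM.law_g n, Nat.cast_one]; rfl
  have hmap : P.map (fun ω => (g 0 ω, g 1 ω)) = (expMeasure 1).prod (expMeasure 1) := by
    have h01 : IndepFun (g 0) (g 1) P :=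
      hM.indep_gains.indepFun (i := Sum.inl 0) (j := Sum.inl 1) (by simp)
    rw [(indepFun_iff_map_prod_eq_prod_map_map (hM.measurable_g 0).aemeasurable
      (hM.measurable_g 1).aemeasurable).mp h01, hlaw, hlaw]
  set S : Set (((ℕ → Plane) × (Fin 2 × ℕ → ℝ)) × (ℝ × ℝ)) := {p | ENNReal.ofReal T ≤
    ENNReal.ofReal p.2.1 / (interferenceFun d p.1.1 (fun i => p.1.2 (0, i)) + ENNReal.ofReal SNR⁻¹) +
    ENNReal.ofReal p.2.2 / (interferenceFun d p.1.1 (fun i => p.1.2 (1, i)) + ENNReal.ofReal SNR⁻¹)}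
    with hS
  have hIm : ∀ n, Measurable fun p : ((ℕ → Plane) × (Fin 2 × ℕ → ℝ)) × (ℝ × ℝ) =>
      interferenceFun d p.1.1 (fun i => p.1.2 (n, i)) := fun n =>
    (measurable_interferenceFun d).comp (Measurable.prodMk (by fun_prop) (by fun_prop))
  have hSm : MeasurableSet S := by
    refine measurableSet_le measurable_const (Measurable.add ?_ ?_)
    · exact (by fun_prop : Measurable fun p : ((ℕ → Plane) × (Fin 2 × ℕ → ℝ)) × (ℝ × ℝ) =>
        ENNReal.ofReal p.2.1).div ((hIm 0).add_const _)
    · exact (by fun_prop : Measurable fun p : ((ℕ → Plane) × (Fin 2 × ℕ → ℝ)) × (ℝ × ℝ) =>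
        ENNReal.ofReal p.2.2).div ((hIm 1).add_const _)
  have hev : {ω | ENNReal.ofReal T ≤ sinrMRC d 4 SNR x g h ω} =
      (fun ω => (((fun i => x i ω), fun p : Fin 2 × ℕ => h p.1 p.2 ω), (g 0 ω, g 1 ω))) ⁻¹' S := by
    ext ω
    simp only [mem_ofPred_eq, mem_preimage, hS, sinrMRC, Fin.sum_univ_two]
    rfl
  have hm0 := (hM.measurable_interference (d := d) 0).ennreal_toReal
  have hm1 := (hM.measurable_interference (d := d) 1).ennreal_toReal
  rw [hev, ← lintegral_indicator_one
    (((hM.measurable_points.prodMk hHm).prodMk hGm) hSm)]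
  have h1 := lintegral_comp_prodMk_of_indepFun hind (hM.measurable_points.prodMk hHm) hGm
    (F := S.indicator 1) (measurable_one.indicator hSm)
  rw [hmap] at h1
  refine h1.trans ?_
  -- Tonelli: after this swap the claim can be checked for each fixed interference.
  refine Eq.trans ?_ (lintegral_lintegral_swap (measurable_ofReal_mul_exp_mul_exp
    (hm0.comp measurable_fst) (hm1.comp measurable_fst) measurable_snd T SNR⁻¹).aemeasurable)
  refine lintegral_congr_ae ?_
  filter_upwards [hM.ae_interference_ne_top hlam hd] with ω hω
  have hs : 0 < SNR⁻¹ := inv_pos.mpr hSNR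
  have hr : ∀ n, 0 < (interference d 4 x (h n) ω).toReal + SNR⁻¹ := fun n => by positivity
  have hI : ∀ n, interferenceFun d (fun i => x i ω) (fun i => h n i ω) + ENNReal.ofReal SNR⁻¹ =
      ENNReal.ofReal ((interference d 4 x (h n) ω).toReal + SNR⁻¹) := fun n => by
    rw [ENNReal.ofReal_add ENNReal.toReal_nonneg hs.le, ENNReal.ofReal_toReal (hω n)]
    rfl
  rw [← expMeasure_prod_sum_ge (hr 0) (hr 1) T, ← lintegral_indicator_one
    (measurableSet_le measurable_const (by fun_prop))]
  refine lintegral_congr_ae ?_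
  -- Nonnegative gains make the truncation in `ENNReal.ofReal` harmless, so the event becomes a real
  -- inequality.
  have hu : ∀ᵐ u ∂(expMeasure 1).prod (expMeasure 1), 0 ≤ u.1 ∧ 0 ≤ u.2 :=
    (Measure.quasiMeasurePreserving_fst.ae ae_expMeasure_one_nonneg).and
      (Measure.quasiMeasurePreserving_snd.ae ae_expMeasure_one_nonneg)
  filter_upwards [hu] with u hu
  have hiff : (((fun i => x i ω), fun p : Fin 2 × ℕ => h p.1 p.2 ω), u) ∈ S ↔
      T ≤ u.1 / ((interference d 4 x (h 0) ω).toReal + SNR⁻¹) +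
        u.2 / ((interference d 4 x (h 1) ω).toReal + SNR⁻¹) := by
    simp only [hS, mem_ofPred_eq, hI]
    rw [← ENNReal.ofReal_div_of_pos (hr 0), ← ENNReal.ofReal_div_of_pos (hr 1),
      ← ENNReal.ofReal_add (div_nonneg hu.1 (hr 0).le) (div_nonneg hu.2 (hr 1).le),
      ENNReal.ofReal_le_ofReal_iff
        (add_nonneg (div_nonneg hu.1 (hr 0).le) (div_nonneg hu.2 (hr 1).le))]
  by_cases hc : (((fun i => x i ω), fun p : Fin 2 × ℕ => h p.1 p.2 ω), u) ∈ S
  · rw [indicator_of_mem hc, indicator_of_mem (by exact hiff.mp hc)]; rfl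
  · rw [indicator_of_notMem hc, indicator_of_notMem (by exact fun hc' => hc (hiff.mpr hc'))]

end IsNakagamiNetwork

/-! ### The derivative in `t` -/

/-- Differentiation of a Laplace transform under the expectation. -/
lemma hasDerivAt_integral_exp_mul {Ω : Type*} [MeasurableSpace Ω] {P : Measure Ω}
    [IsProbabilityMeasure P] {r A : Ω → ℝ} (hr : Measurable r) (hA : Measurable A)
    (hr0 : ∀ ω, 0 ≤ r ω) (hA0 : ∀ ω, 0 ≤ A ω) (hA1 : ∀ ω, A ω ≤ 1) {z : ℝ} (hz : 0 < z) :
    HasDerivAt (fun t => ∫ ω, Real.exp (-(z * t * r ω)) * A ω ∂P)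
      (-(z * ∫ ω, r ω * Real.exp (-(z * r ω)) * A ω ∂P)) 1 := by
  have h := hasDerivAt_integral_of_dominated_loc_of_deriv_le (μ := P) (x₀ := (1 : ℝ))
    -- For `t > 1 / 2` the derivative is at most `2 y exp(-y)` in modulus, with `y = z r / 2`, and
    -- `y exp(-y) ≤ 1`. Thus no moment of `r` is required.
    (s := Ioi (1 / 2)) (bound := fun _ => 2)
    (F := fun t ω => Real.exp (-(z * t * r ω)) * A ω)
    (F' := fun t ω => -(z * (r ω * Real.exp (-(z * t * r ω)) * A ω)))
    (Ioi_mem_nhds (by norm_num)) (Eventually.of_forall fun t => by fun_prop)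
    (Integrable.of_bound (by fun_prop) 1 (ae_of_all _ fun ω => ?_))
    (by fun_prop) (ae_of_all _ fun ω t ht => ?_) (by fun_prop) (ae_of_all _ fun ω t ht => ?_)
  · have h2 := h.2
    simp only [mul_one] at h2
    rw [integral_neg, integral_const_mul] at h2
    exact h2
  · rw [Real.norm_of_nonneg (mul_nonneg (Real.exp_pos _).le (hA0 ω))]
    refine mul_le_one₀ (Real.exp_le_one_iff.mpr ?_) (hA0 ω) (hA1 ω)
    have := hr0 ω
    simp only [mul_one, Left.neg_nonpos_iff]
    positivity
  · have ht : 1 / 2 < t := ht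
    have hr1 := hr0 ω
    have hA1' := hA0 ω
    rw [norm_neg, Real.norm_of_nonneg (by positivity)]
    have h1 : Real.exp (-(z * t * r ω)) ≤ Real.exp (-(z * r ω / 2)) := by
      refine Real.exp_le_exp.mpr (neg_le_neg ?_)
      nlinarith [mul_nonneg hz.le hr1]
    have h2 : z * r ω / 2 ≤ Real.exp (z * r ω / 2) := by
      linarith [Real.add_one_le_exp (z * r ω / 2)]
    have h3 : z * r ω / 2 * Real.exp (-(z * r ω / 2)) ≤ 1 := by
      rw [Real.exp_neg, ← div_eq_mul_inv]
      exact div_le_one_of_le₀ h2 (Real.exp_pos _).le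
    calc z * (r ω * Real.exp (-(z * t * r ω)) * A ω)
        ≤ z * (r ω * Real.exp (-(z * r ω / 2)) * 1) := by gcongr; exact hA1 ω
      _ = 2 * (z * r ω / 2 * Real.exp (-(z * r ω / 2))) := by ring
      _ ≤ 2 := by linarith
  · have h1 : HasDerivAt (fun t => -(z * t * r ω)) (-(z * 1 * r ω)) t :=
      (((hasDerivAt_id t).const_mul z).mul_const (r ω)).neg
    refine (h1.exp.mul_const (A ω)).congr_deriv ?_
    ring

/-- The `t`-derivative of `mrcExp` exists away from `z = T / 2`, and the integrand is an expectation
over the interference. -/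
lemma IsNakagamiNetwork.mrcIntegrand_eq {Ω : Type*} [MeasurableSpace Ω] {P : Measure Ω}
    [IsProbabilityMeasure P] {lam d SNR T : ℝ} {x : ℕ → Ω → Plane} {mD : ℕ} {g : Fin 2 → Ω → ℝ}
    {h : Fin 2 → ℕ → Ω → ℝ} (hM : IsNakagamiNetwork P 2 lam mD 1 x g h) (hlam : 0 ≤ lam)
    (hd : 0 < d) (hSNR : 0 < SNR) {z : ℝ} (hz : 0 < z) (hzT : z ≠ T / 2) :
    DifferentiableAt ℝ (fun t => mrcExp lam d SNR T z t) 1 ∧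
    mrcIntegrand lam d SNR T z = -(∫⁻ ω, ENNReal.ofReal
        (((interference d 4 x (h 1) ω).toReal + SNR⁻¹) *
          Real.exp (-(z * ((interference d 4 x (h 1) ω).toReal + SNR⁻¹))) *
          Real.exp (-(max 0 (T - z) * ((interference d 4 x (h 0) ω).toReal + SNR⁻¹))))
            ∂P).toReal := by
  have hs : 0 < SNR⁻¹ := inv_pos.mpr hSNR
  set m := max 0 (T - z) with hm
  have hm0 : 0 ≤ m := le_max_left _ _
  -- Equality would force `z = T - z`; the quotient in `mrcExp` is then `0 / 0` at `t = 1`.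
  have hzm : z ≠ m := by
    intro hzm
    rcases max_choice 0 (T - z) with hc | hc
    · exact hz.ne' (by rw [hzm, hm, hc])
    · exact hzT (by rw [← hm, ← hzm] at hc; linarith)
  set r : Fin 2 → Ω → ℝ := fun n ω => (interference d 4 x (h n) ω).toReal + SNR⁻¹ with hr
  have hrm : ∀ n, Measurable (r n) := fun n =>
    (hM.measurable_interference (d := d) n).ennreal_toReal.add_const _
  have hr0 : ∀ n ω, 0 ≤ r n ω := fun n ω => by simp only [hr]; positivity
  have hAm : Measurable fun ω => Real.exp (-(m * r 0 ω)) := by have := hrm 0; fun_prop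
  have hder := hasDerivAt_integral_exp_mul (P := P) (hrm 1) hAm (hr0 1)
    (fun ω => (Real.exp_pos _).le)
    (fun ω => Real.exp_le_one_iff.mpr (neg_nonpos.mpr (mul_nonneg hm0 (hr0 0 ω)))) hz
  -- `mrcExp` lacks the noise factor `exp(-m / SNR)` of the first branch, hence the compensating
  -- `exp(m / SNR)`; it cancels against the prefactor in `mrcIntegrand`. The transform formula
  -- requires `z t ≠ m`, which holds only near `t = 1`.
  have heq : (fun t => mrcExp lam d SNR T z t) =ᶠ[𝓝 1] fun t =>
      Real.exp (m / SNR) * ∫ ω, Real.exp (-(z * t * r 1 ω)) * Real.exp (-(m * r 0 ω)) ∂P := by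
    have hne : ∀ᶠ t in 𝓝 (1 : ℝ), z * t ≠ m :=
      (by fun_prop : Continuous fun t : ℝ => z * t).continuousAt.eventually_ne (by simpa using hzm)
    filter_upwards [hne, eventually_gt_nhds zero_lt_one] with t ht ht0
    have hL := hM.integral_exp_interference hlam hd hm0 (by positivity : 0 ≤ z * t) ht.symm
    have hfac : ∀ ω, Real.exp (-(z * t * r 1 ω)) * Real.exp (-(m * r 0 ω)) =
        Real.exp (-(z * t / SNR) - m / SNR) * Real.exp (-(m * (interference d 4 x (h 0) ω).toReal +
          z * t * (interference d 4 x (h 1) ω).toReal)) := fun ω => by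
      rw [← Real.exp_add, ← Real.exp_add]
      simp only [hr]
      congr 1
      field_simp
      ring
    simp_rw [hfac]
    rw [integral_const_mul, hL, mrcExp, ← Real.exp_add, ← Real.exp_add]
    congr 1
    ring
  have hder' := (hder.const_mul (Real.exp (m / SNR))).congr_of_eventuallyEq heq
  refine ⟨hder'.differentiableAt, ?_⟩
  rw [mrcIntegrand, hder'.deriv, ← integral_eq_lintegral_of_nonneg_ae]
  · rw [← hm, Real.exp_neg]
    have := (Real.exp_pos (m / SNR)).ne'
    change _ = -∫ ω, r 1 ω * Real.exp (-(z * r 1 ω)) * Real.exp (-(m * r 0 ω)) ∂P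
    generalize ∫ ω, r 1 ω * Real.exp (-(z * r 1 ω)) * Real.exp (-(m * r 0 ω)) ∂P = J
    field_simp
  · exact ae_of_all _ fun ω => by
      have := hr0 1 ω
      simp only [hr] at this
      simp only [Pi.zero_apply]
      positivity
  · have h1 := hrm 0
    have h2 := hrm 1
    exact (by fun_prop : Measurable fun ω => r 1 ω * Real.exp (-(z * r 1 ω)) *
      Real.exp (-(m * r 0 ω))).aestronglyMeasurable

end InterferenceLaplace

/-! ### The success probability formula -/

theorem mainTheorem7 {Ω : Type*} [MeasurableSpace Ω] (P : Measure Ω) [IsProbabilityMeasure P]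
    (lam d SNR T : ℝ) (hlam : 0 < lam) (hd : 0 < d) (hSNR : 0 < SNR) (hT : 0 < T)
    (x : ℕ → Ω → Plane) (g : Fin 2 → Ω → ℝ) (h : Fin 2 → ℕ → Ω → ℝ)
    (hmodel : IsNakagamiNetwork P 2 lam 1 1 x g h) :
    (∀ z : ℝ, 0 < z → z ≠ T / 2 →
      DifferentiableAt ℝ (fun t => mrcExp lam d SNR T z t) 1) ∧
    IntegrableOn (fun z => mrcIntegrand lam d SNR T z) (Ioi 0) volume ∧
    successProb P d 4 SNR T x g h =
      -∫ z in Ioi (0 : ℝ), mrcIntegrand lam d SNR T z := by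
  set L : ℝ → ENNReal := fun z => ∫⁻ ω, ENNReal.ofReal
    (((interference d 4 x (h 1) ω).toReal + SNR⁻¹) *
      Real.exp (-(z * ((interference d 4 x (h 1) ω).toReal + SNR⁻¹))) *
      Real.exp (-(max 0 (T - z) * ((interference d 4 x (h 0) ω).toReal + SNR⁻¹)))) ∂P with hL
  have hLm : Measurable L := by
    have h0 := (hmodel.measurable_interference (d := d) 0).ennreal_toReal
    have h1 := (hmodel.measurable_interference (d := d) 1).ennreal_toReal
    exact Measurable.lintegral_prod_right' (f := fun p : ℝ × Ω => ENNReal.ofReal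
      (((interference d 4 x (h 1) p.2).toReal + SNR⁻¹) *
      Real.exp (-(p.1 * ((interference d 4 x (h 1) p.2).toReal + SNR⁻¹))) *
      Real.exp (-(max 0 (T - p.1) * ((interference d 4 x (h 0) p.2).toReal + SNR⁻¹)))))
      (measurable_ofReal_mul_exp_mul_exp (h0.comp measurable_snd) (h1.comp measurable_snd)
        measurable_fst T SNR⁻¹)
  have hP : P {ω | ENNReal.ofReal T ≤ sinrMRC d 4 SNR x g h ω} = ∫⁻ z in Ioi 0, L z :=
    hmodel.measure_sinrMRC_ge hlam.le hd hSNR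
  -- The integral of `L` is a probability, which is what yields integrability of the integrand.
  have hfin : ∫⁻ z in Ioi 0, L z ≠ ⊤ := hP ▸ measure_ne_top P _
  have hae : (fun z => mrcIntegrand lam d SNR T z) =ᵐ[volume.restrict (Ioi 0)]
      fun z => -(L z).toReal := by
    have h0 : ∀ᵐ z : ℝ ∂volume.restrict (Ioi 0), z ≠ T / 2 :=
      ae_restrict_of_ae (by simp [ae_iff])
    filter_upwards [h0, ae_restrict_mem measurableSet_Ioi] with z hzT hz
    exact (hmodel.mrcIntegrand_eq hlam.le hd hSNR hz hzT).2
  refine ⟨fun z hz hzT => (hmodel.mrcIntegrand_eq hlam.le hd hSNR hz hzT).1, ?_, ?_⟩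
  · exact (integrable_congr hae).mpr
      (integrable_toReal_of_lintegral_ne_top hLm.aemeasurable hfin).neg
  · rw [integral_congr_ae hae, integral_neg, neg_neg,
      integral_toReal hLm.aemeasurable (ae_lt_top hLm hfin), ← hP]
    rfl
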